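/- For a positive Borel measure $\mu$ on $\mathbb R$ with moments $s_n=\int x^n\,d\mu(x)$ of every order $n\ge 0$, let $\lambda_N$ denote the smallest eigenvalue of the $(N+1)\times(N+1)$ Hankel matrix $\mathcal H_N=(s_{j+k})_{j,k=0}^{N}$. The measure $\mu$ is called determinate if it is the only positive Borel measure on $\mathbb R$ with the moments $(s_n)$, and symmetric if it is invariant under $x\mapsto -x$. Let $(\tau_n)_{n\ge 0}$ be a decreasing sequence of positive numbers satisfying $\tau_n\to 0$ and $\tau_0<1$. Then there exists a determinate symmetric probability measure $\mu$ on $\mathbb R$, with moments of every order, for which $$\lambda_N\ge \tfrac12\,\tau_N\quad\text{for all } N\ge 0 .$$ Moreover $\lambda_N\to 0$ as $N\to\infty$ for this measure. In other words, the eigenvalues $\lambda_N$ can decay to $0$ arbitrarily slowly. -/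

import Mathlib

open MeasureTheory Filter Topology

/-- The measure `μ` on the real line has moments of every order. -/
def HasAllMoments (μ : Measure ℝ) : Prop :=
  ∀ n : ℕ, Integrable (fun x : ℝ => x ^ n) μ

/-- The `n`-th moment `s_n = ∫ x ^ n dμ(x)`. -/
noncomputable def realMoment (μ : Measure ℝ) (n : ℕ) : ℝ :=
  ∫ x, x ^ n ∂μ

/-- The measure `μ` is determinate: it has moments of every order, and it is the only positive
Borel measure on `ℝ` that has the moments of `μ`. -/
def IsDeterminate (μ : Measure ℝ) : Prop :=
  HasAllMoments μ ∧
    ∀ ν : Measure ℝ, HasAllMoments ν → (∀ n : ℕ, realMoment ν n = realMoment μ n) → ν = μ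

/-- The `(N + 1) × (N + 1)` Hankel matrix `(s_{j + k})`, `0 ≤ j, k ≤ N`. -/
noncomputable def hankelMatrix (μ : Measure ℝ) (N : ℕ) :
    Matrix (Fin (N + 1)) (Fin (N + 1)) ℝ :=
  Matrix.of fun j k => realMoment μ ((j : ℕ) + (k : ℕ))

theorem hankelMatrix_isHermitian (μ : Measure ℝ) (N : ℕ) : (hankelMatrix μ N).IsHermitian := by
  ext j k
  simp [hankelMatrix, add_comm]

/-- The smallest eigenvalue `λ_N` of the Hankel matrix: the least of its finitely many (and at
least one) real eigenvalues. -/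
noncomputable def smallestHankelEigenvalue (μ : Measure ℝ) (N : ℕ) : ℝ :=
  Finset.univ.inf' Finset.univ_nonempty (hankelMatrix_isHermitian μ N).eigenvalues

/-! The measure is discrete, with equal masses at `± x n`, and is built one pair at a time. Let `P
n` be the even polynomial with value `1` at `0` vanishing at the first `n` pairs (`nodePoly`), and
give `± x n` the mass `ε n / P n (x n) ^ 2`. Two opposing effects are balanced.

Smallness: `P n` kills the earlier nodes, contributes `2 * ε n` at `± x n`, and the later masses are
negligible, so `∫ P n ^ 2` is about `2 * ε n` (`integral_nodePoly_sq_le`). If `ε` is small along a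
subsequence, then `λ_N → 0`, because `P n` has constant coefficient `1`. Determinacy also follows
(`isDeterminate_of_exists_small`): `P n` tends to `0` in `L²` along that subsequence, while `P n (i)
= ∏ (1 + 1 / x k ^ 2) ≥ 1`.

Largeness: for `p` of degree below `2 * (n + 1)`, the squared coefficient norm is at most `u n`
times the energy of `p` on the first `n + 1` pairs (`IsGoodNode.energy_ge`). Dividing `p` by `P (n +
1)` and sending the new node far out shows that one more pair costs only slightly more than `4 / ε
(n + 1)` in this constant (`norm_coeffVec_sq_le_of_pair`). Hence `u (n + 1) > u n + 4 / ε (n + 1)`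
suffices.

It remains to find `u` below `1 / τ` that grows arbitrarily slowly and yet has unbounded increments
(`exists_strictMono_unbounded_increments`), since `ε (n + 1)` is a multiple of the reciprocal
increment. Normalizing the total mass, which lies in `[1, 2]`, costs the factor `1 / 2`. -/

/-! ### Hankel quadratic form and its smallest eigenvalue -/

section HankelForm

open Polynomial Matrix

theorem HasAllMoments.integrable_eval {μ : Measure ℝ} (h : HasAllMoments μ) (p : ℝ[X]) :
    Integrable (fun x => p.eval x) μ := by
  simp only [eval_eq_sum_range]
  exact integrable_finsetSum _ fun i _ => (h i).const_mul _

theorem HasAllMoments.integrable_eval_sq {μ : Measure ℝ} (h : HasAllMoments μ) (p : ℝ[X]) :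
    Integrable (fun x => p.eval x ^ 2) μ :=
  (h.integrable_eval (p ^ 2)).congr (ae_of_all _ fun x => eval_pow (x := x) 2)

theorem HasAllMoments.integral_eval {μ : Measure ℝ} (h : HasAllMoments μ) (p : ℝ[X]) :
    ∫ x, p.eval x ∂μ = ∑ i ∈ Finset.range (p.natDegree + 1), p.coeff i * realMoment μ i := by
  simp only [eval_eq_sum_range]
  rw [integral_finsetSum _ fun i _ => (h i).const_mul _]
  exact Finset.sum_congr rfl fun i _ => integral_const_mul _ _

theorem HasAllMoments.isFiniteMeasure {μ : Measure ℝ} (h : HasAllMoments μ) :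
    IsFiniteMeasure μ := by
  have := h 0
  simp only [pow_zero] at this
  exact (integrable_const_iff_isFiniteMeasure one_ne_zero).1 this

theorem HasAllMoments.dotProduct_hankelMatrix {μ : Measure ℝ} (h : HasAllMoments μ) (N : ℕ)
    (v : Fin (N + 1) → ℝ) :
    v ⬝ᵥ (hankelMatrix μ N *ᵥ v) = ∫ x, (∑ i, v i * x ^ (i : ℕ)) ^ 2 ∂μ := by
  have h1 : ∀ x : ℝ, (∑ i, v i * x ^ (i : ℕ)) ^ 2
      = ∑ i : Fin (N + 1), ∑ j : Fin (N + 1), v i * v j * x ^ ((i : ℕ) + (j : ℕ)) := fun x => by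
    rw [sq, Finset.sum_mul_sum]
    refine Finset.sum_congr rfl fun i _ => Finset.sum_congr rfl fun j _ => ?_
    ring
  simp only [h1]
  rw [integral_finsetSum _ fun i _ => integrable_finsetSum _ fun j _ => (h _).const_mul _]
  simp only [dotProduct, mulVec, Finset.mul_sum]
  refine Finset.sum_congr rfl fun i _ => ?_
  rw [integral_finsetSum _ fun j _ => (h _).const_mul _]
  refine Finset.sum_congr rfl fun j _ => ?_
  rw [integral_const_mul]
  simp only [hankelMatrix, of_apply, realMoment]
  ring

theorem eval_eq_sum_fin {p : ℝ[X]} {N : ℕ} (hp : p.natDegree ≤ N) (x : ℝ) :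
    p.eval x = ∑ i : Fin (N + 1), p.coeff i * x ^ (i : ℕ) := by
  rw [eval_eq_sum_range' (Nat.lt_succ_of_le hp), Finset.sum_range]

/-- The Hankel form at a coefficient vector is `∫ p ^ 2`; each eigenvalue is its value at a unit
eigenvector. -/
theorem le_smallestHankelEigenvalue {μ : Measure ℝ} (h : HasAllMoments μ) {N : ℕ} {c : ℝ}
    (hc : ∀ p : ℝ[X], p.natDegree ≤ N →
      c * ∑ i : Fin (N + 1), p.coeff i ^ 2 ≤ ∫ x, p.eval x ^ 2 ∂μ) :
    c ≤ smallestHankelEigenvalue μ N := by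
  refine (Finset.le_inf'_iff _ _).2 fun i _ => ?_
  set hA := hankelMatrix_isHermitian μ N
  set v : Fin (N + 1) → ℝ := ⇑(hA.eigenvectorBasis i)
  have hv : ∑ j, v j ^ 2 = 1 := by
    have h1 := hA.eigenvectorBasis.orthonormal.1 i
    have h2 := EuclideanSpace.real_norm_sq_eq (hA.eigenvectorBasis i)
    rw [h1] at h2
    simpa using h2.symm
  have h3 : hA.eigenvalues i = v ⬝ᵥ (hankelMatrix μ N *ᵥ v) := by
    rw [hA.eigenvalues_eq i]; simp [v]
  rw [h3, h.dotProduct_hankelMatrix]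
  set p : ℝ[X] := ∑ j : Fin (N + 1), C (v j) * X ^ (j : ℕ)
  have hdeg : p.natDegree ≤ N := natDegree_sum_le_of_forall_le _ _ fun j _ =>
    (natDegree_C_mul_X_pow_le _ _).trans (Nat.lt_succ_iff.1 j.2)
  have hcoeff : ∀ j : Fin (N + 1), p.coeff j = v j := fun j => by
    simp [p, coeff_C_mul, coeff_X_pow, Fin.val_inj]
  have h4 := hc p hdeg
  simp only [eval_eq_sum_fin hdeg, hcoeff, hv, mul_one] at h4
  exact h4

/-- Rayleigh bound, from expanding the coefficient vector in the orthonormal eigenbasis. -/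
theorem smallestHankelEigenvalue_mul_le {μ : Measure ℝ} (h : HasAllMoments μ) {N : ℕ} {p : ℝ[X]}
    (hp : p.natDegree ≤ N) :
    smallestHankelEigenvalue μ N * ∑ i : Fin (N + 1), p.coeff i ^ 2 ≤ ∫ x, p.eval x ^ 2 ∂μ := by
  set hA := hankelMatrix_isHermitian μ N
  set v : Fin (N + 1) → ℝ := fun i => p.coeff i
  set w : EuclideanSpace ℝ (Fin (N + 1)) := WithLp.toLp 2 v
  set b := hA.eigenvectorBasis
  have h1 : ∑ i : Fin (N + 1), p.coeff i ^ 2 = ∑ i, inner ℝ w (b i) * inner ℝ (b i) w := by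
    rw [b.sum_inner_mul_inner, real_inner_self_eq_norm_sq, EuclideanSpace.real_norm_sq_eq]
  have h2 : ∀ i, inner ℝ (b i) (WithLp.toLp 2 (hankelMatrix μ N *ᵥ v))
      = hA.eigenvalues i * inner ℝ (b i) w := fun i => by
    have e1 : inner ℝ (b i) (WithLp.toLp 2 (hankelMatrix μ N *ᵥ v))
        = (hankelMatrix μ N *ᵥ ⇑(b i)) ⬝ᵥ v := by
      rw [EuclideanSpace.inner_eq_star_dotProduct]
      simp only [star_trivial]
      rw [dotProduct_comm, dotProduct_mulVec, ← mulVec_transpose]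
      congr 2
    rw [e1, hA.mulVec_eigenvectorBasis, smul_dotProduct, EuclideanSpace.inner_eq_star_dotProduct]
    simp [w, b, dotProduct_comm]
  have h3 : ∫ x, p.eval x ^ 2 ∂μ = ∑ i, inner ℝ w (b i) * (hA.eigenvalues i * inner ℝ (b i) w) := by
    simp only [eval_eq_sum_fin hp]
    rw [← h.dotProduct_hankelMatrix N v]
    simp only [← h2]
    rw [b.sum_inner_mul_inner, EuclideanSpace.inner_eq_star_dotProduct]
    simp [w, dotProduct_comm]
  rw [h1, h3, Finset.mul_sum]
  refine Finset.sum_le_sum fun i _ => ?_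
  have h4 : smallestHankelEigenvalue μ N ≤ hA.eigenvalues i :=
    Finset.inf'_le _ (Finset.mem_univ i)
  rw [real_inner_comm]
  nlinarith [mul_le_mul_of_nonneg_right h4 (mul_self_nonneg (inner ℝ (b i) w))]

end HankelForm

/-! ### A determinacy criterion from polynomials small in `L²` -/

section Determinacy

open Polynomial

theorem integral_abs_le_of_sq {μ : Measure ℝ} {f g : ℝ → ℝ} (hf : Integrable (fun x => f x ^ 2) μ)
    (hg : Integrable (fun x => g x ^ 2) μ) {a : ℝ} (ha : 0 < a) :
    |∫ x, f x * g x ∂μ| ≤ a * ∫ x, f x ^ 2 ∂μ + a⁻¹ * ∫ x, g x ^ 2 ∂μ := by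
  rw [← integral_const_mul, ← integral_const_mul,
    ← integral_add (hf.const_mul _) (hg.const_mul _), ← Real.norm_eq_abs]
  refine norm_integral_le_of_norm_le ((hf.const_mul _).add (hg.const_mul _)) (ae_of_all _ fun x => ?_)
  rw [Real.norm_eq_abs, abs_mul]
  have h : a * f x ^ 2 + a⁻¹ * g x ^ 2 = a * |f x| ^ 2 + a⁻¹ * |g x| ^ 2 := by simp
  simp only [h]
  have h2 : a * |f x| ^ 2 + a⁻¹ * |g x| ^ 2 - |f x| * |g x|
      = a⁻¹ * ((a * |f x| - |g x| / 2) ^ 2 + 3 / 4 * |g x| ^ 2) := by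
    field_simp; ring
  have h3 : 0 ≤ a⁻¹ * ((a * |f x| - |g x| / 2) ^ 2 + 3 / 4 * |g x| ^ 2) := by positivity
  linarith

/-- The quotient of `Q` by a power of `1 + x ^ 2`, as a function. -/
noncomputable def cauchyQuotient (Q : ℝ[X]) (s : ℕ) (x : ℝ) : ℝ := Q.eval x / (1 + x ^ 2) ^ s

theorem one_le_one_add_sq_pow (s : ℕ) (x : ℝ) : 1 ≤ (1 + x ^ 2) ^ s :=
  one_le_pow₀ (by nlinarith [sq_nonneg x])

theorem abs_cauchyQuotient_le (Q : ℝ[X]) (s : ℕ) (x : ℝ) : |cauchyQuotient Q s x| ≤ |Q.eval x| := by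
  have h := one_le_one_add_sq_pow s x
  rw [cauchyQuotient, abs_div, abs_of_pos (lt_of_lt_of_le one_pos h)]
  exact div_le_self (abs_nonneg _) h

theorem continuous_cauchyQuotient (Q : ℝ[X]) (s : ℕ) : Continuous (cauchyQuotient Q s) :=
  Q.continuous.div (by fun_prop) fun x => (lt_of_lt_of_le one_pos (one_le_one_add_sq_pow s x)).ne'

theorem HasAllMoments.integrable_cauchyQuotient {μ : Measure ℝ} (h : HasAllMoments μ) (Q : ℝ[X])
    (s : ℕ) : Integrable (cauchyQuotient Q s) μ :=
  (h.integrable_eval Q).mono (continuous_cauchyQuotient Q s).aestronglyMeasurable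
    (ae_of_all _ fun x => abs_cauchyQuotient_le Q s x)

theorem HasAllMoments.integrable_cauchyQuotient_sq {μ : Measure ℝ} (h : HasAllMoments μ)
    (Q : ℝ[X]) (s : ℕ) : Integrable (fun x => cauchyQuotient Q s x ^ 2) μ := by
  refine (h.integrable_cauchyQuotient (Q ^ 2) (s * 2)).congr (ae_of_all _ fun x => ?_)
  simp [cauchyQuotient, div_pow, pow_mul]

/-- Induction on `s`. Modulo `1 + x ^ 2` the polynomial `P` is the constant `c`, so `1 / (1 + x ^
2)` is a polynomial plus `c⁻¹ * P / (1 + x ^ 2)`. The first part lowers `s`; the second is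
negligible for both measures, since `∫ P ^ 2` depends only on the moments. -/
theorem integral_cauchyQuotient_congr {μ ν : Measure ℝ} (hμ : HasAllMoments μ)
    (hν : HasAllMoments ν) (hmom : ∀ n, realMoment ν n = realMoment μ n)
    (hP : ∀ δ > 0, ∃ (P T : ℝ[X]) (c : ℝ), 1 ≤ c ∧ P = C c + (1 + X ^ 2) * T ∧
      ∫ x, P.eval x ^ 2 ∂μ < δ) (s : ℕ) (Q : ℝ[X]) :
    ∫ x, cauchyQuotient Q s x ∂ν = ∫ x, cauchyQuotient Q s x ∂μ := by
  have hpoly : ∀ p : ℝ[X], ∫ x, p.eval x ∂ν = ∫ x, p.eval x ∂μ := fun p => by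
    simp [hν.integral_eval, hμ.integral_eval, hmom]
  induction s generalizing Q with
  | zero => simpa [cauchyQuotient] using hpoly Q
  | succ s ih =>
    set F := cauchyQuotient Q (s + 1)
    have key : ∀ (P T : ℝ[X]) (c : ℝ), 1 ≤ c → P = C c + (1 + X ^ 2) * T →
        ∀ x, F x = cauchyQuotient (-(C c⁻¹ * T * Q)) s x + c⁻¹ * (F x * P.eval x) := by
      intro P T c hc hPT x
      have h0 : (0 : ℝ) < 1 + x ^ 2 := by positivity
      have hc0 : c ≠ 0 := by positivity
      simp only [F, cauchyQuotient, hPT, eval_neg, eval_mul, eval_C, eval_add, eval_one, eval_pow,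
        eval_X, pow_succ (1 + x ^ 2)]
      field_simp
      ring
    have bound : ∀ (P : ℝ[X]) (κ : Measure ℝ), HasAllMoments κ → ∀ a > 0,
        |∫ x, F x * P.eval x ∂κ| ≤ a * ∫ x, F x ^ 2 ∂κ + a⁻¹ * ∫ x, P.eval x ^ 2 ∂κ :=
      fun P κ hκ a ha => integral_abs_le_of_sq (hκ.integrable_cauchyQuotient_sq _ _)
        (hκ.integrable_eval_sq P) ha
    have hint : ∀ (P : ℝ[X]) (κ : Measure ℝ), HasAllMoments κ →
        Integrable (fun x => F x * P.eval x) κ := fun P κ hκ =>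
      (hκ.integrable_cauchyQuotient (Q * P) (s + 1)).congr (ae_of_all _ fun x => by
        simp [F, cauchyQuotient, div_mul_eq_mul_div])
    set A := (∫ x, F x ^ 2 ∂ν) + ∫ x, F x ^ 2 ∂μ
    have hA : 0 ≤ A := add_nonneg (integral_nonneg fun x => sq_nonneg _)
      (integral_nonneg fun x => sq_nonneg _)
    have main : ∀ a > 0, |∫ x, F x ∂ν - ∫ x, F x ∂μ| ≤ a * (A + 2) := by
      intro a ha
      -- With `∫ P ^ 2 < a ^ 2`, the term `a⁻¹ * ∫ P ^ 2` is at most `a` for each of the two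
      -- measures.
      obtain ⟨P, T, c, hc, hPT, hlt⟩ := hP (a ^ 2) (by positivity)
      have hsplit : ∀ κ : Measure ℝ, HasAllMoments κ → ∫ x, F x ∂κ
          = ∫ x, cauchyQuotient (-(C c⁻¹ * T * Q)) s x ∂κ + c⁻¹ * ∫ x, F x * P.eval x ∂κ :=
        fun κ hκ => by
          rw [← integral_const_mul, ← integral_add (hκ.integrable_cauchyQuotient _ _)
            ((hint P κ hκ).const_mul _)]
          exact integral_congr_ae (ae_of_all _ (key P T c hc hPT))
      rw [hsplit ν hν, hsplit μ hμ, ih, add_sub_add_left_eq_sub, ← mul_sub, abs_mul]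
      have hc1 : |c⁻¹| ≤ 1 := by
        rw [abs_of_nonneg (by positivity)]; exact inv_le_one_of_one_le₀ hc
      have e : ∫ x, P.eval x ^ 2 ∂ν = ∫ x, P.eval x ^ 2 ∂μ := by
        have := hpoly (P ^ 2)
        simp only [eval_pow] at this
        exact this
      have b1 := bound P ν hν a ha
      have b2 := bound P μ hμ a ha
      rw [e] at b1
      have hlt' : a⁻¹ * ∫ x, P.eval x ^ 2 ∂μ ≤ a := by
        rw [inv_mul_le_iff₀ ha]; nlinarith
      calc _ ≤ 1 * |∫ x, F x * P.eval x ∂ν - ∫ x, F x * P.eval x ∂μ| :=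
            mul_le_mul_of_nonneg_right hc1 (abs_nonneg _)
        _ ≤ |∫ x, F x * P.eval x ∂ν| + |∫ x, F x * P.eval x ∂μ| := by
            rw [one_mul]; exact abs_sub _ _
        _ ≤ _ := by simp only [A]; linarith
    by_contra hne
    have hpos : 0 < |∫ x, F x ∂ν - ∫ x, F x ∂μ| := abs_pos.2 (sub_ne_zero.2 hne)
    have := main (|∫ x, F x ∂ν - ∫ x, F x ∂μ| / (2 * (A + 2))) (by positivity)
    rw [div_mul_eq_mul_div, le_div_iff₀ (by positivity)] at this
    nlinarith

/-- Bounded continuous functions of the form `Q(x) / (1 + x ^ 2) ^ s`. -/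
noncomputable def cauchySubalgebra : StarSubalgebra ℝ (BoundedContinuousFunction ℝ ℝ) where
  carrier := {f | ∃ (Q : ℝ[X]) (s : ℕ), ∀ x, f x = cauchyQuotient Q s x}
  mul_mem' := by
    rintro f g ⟨Q, s, hf⟩ ⟨R, t, hg⟩
    refine ⟨Q * R, s + t, fun x => ?_⟩
    simp [hf, hg, cauchyQuotient, pow_add, div_mul_div_comm]
  add_mem' := by
    rintro f g ⟨Q, s, hf⟩ ⟨R, t, hg⟩
    refine ⟨Q * (1 + X ^ 2) ^ t + R * (1 + X ^ 2) ^ s, s + t, fun x => ?_⟩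
    have h0 : (0 : ℝ) < 1 + x ^ 2 := by positivity
    simp only [BoundedContinuousFunction.coe_add, Pi.add_apply, hf, hg, cauchyQuotient, eval_add,
      eval_mul, eval_pow, eval_one, eval_X, pow_add]
    field_simp
  algebraMap_mem' := fun r => ⟨C r, 0, fun x => by simp [cauchyQuotient]⟩
  star_mem' := by
    rintro f ⟨Q, s, hf⟩
    exact ⟨Q, s, fun x => by simp [hf]⟩

theorem exists_mem_cauchySubalgebra (Q : ℝ[X]) (hQ : ∀ x : ℝ, |Q.eval x| ≤ 1 + x ^ 2) :
    ∃ f ∈ cauchySubalgebra, ∀ x, f x = cauchyQuotient Q 1 x := by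
  refine ⟨BoundedContinuousFunction.ofNormedAddCommGroup (cauchyQuotient Q 1)
    (continuous_cauchyQuotient Q 1) 1 fun x => ?_, ⟨Q, 1, fun x => rfl⟩, fun x => rfl⟩
  have h0 : (0 : ℝ) < 1 + x ^ 2 := by positivity
  rw [cauchyQuotient, pow_one, Real.norm_eq_abs, abs_div, abs_of_pos h0, div_le_one h0]
  exact hQ x

/-- Equal integrals on a point-separating star subalgebra of bounded continuous functions force
equality of finite measures. Points not separated by `1 / (1 + x ^ 2)` are separated by `x / (1 + x
^ 2)`. -/
theorem isDeterminate_of_exists_small {μ : Measure ℝ} (hμ : HasAllMoments μ)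
    (hP : ∀ δ > 0, ∃ (P T : ℝ[X]) (c : ℝ), 1 ≤ c ∧ P = C c + (1 + X ^ 2) * T ∧
      ∫ x, P.eval x ^ 2 ∂μ < δ) : IsDeterminate μ := by
  refine ⟨hμ, fun ν hν hmom => ?_⟩
  have := hμ.isFiniteMeasure
  have := hν.isFiniteMeasure
  refine ext_of_forall_mem_subalgebra_integral_eq_of_pseudoEMetric_complete_countable
    (𝕜 := ℝ) (A := cauchySubalgebra) ?_ ?_
  · intro x y hxy
    obtain ⟨f, hf, hfx⟩ := exists_mem_cauchySubalgebra 1 fun x => by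
      simpa using sq_nonneg x
    obtain ⟨g, hg, hgx⟩ := exists_mem_cauchySubalgebra X fun x => by
      rw [eval_X, abs_le]; constructor <;> nlinarith [sq_nonneg (x + 1), sq_nonneg (x - 1)]
    by_cases h : f x = f y
    · refine ⟨g, ⟨_, ⟨g, hg, rfl⟩, rfl⟩, fun h' => hxy ?_⟩
      have h1 : g x = g y := h'
      have hx : (0 : ℝ) < 1 + x ^ 2 := by positivity
      have hy : (0 : ℝ) < 1 + y ^ 2 := by positivity
      simp only [hfx, hgx, cauchyQuotient, eval_one, eval_X, pow_one, div_eq_mul_inv, one_mul]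
        at h h1
      rw [h] at h1
      exact mul_right_cancel₀ (inv_pos.2 hy).ne' h1
    · exact ⟨f, ⟨_, ⟨f, hf, rfl⟩, rfl⟩, h⟩
  · rintro g ⟨Q, s, hg⟩
    simp only [hg]
    exact integral_cauchyQuotient_congr hμ hν hmom hP s Q

end Determinacy

/-! ### Node polynomials, masses, and the cost of adding one pair -/

section Nodes

open Polynomial

/-- The vector of the first `d` coefficients of a real polynomial. -/
noncomputable def coeffVec (d : ℕ) : ℝ[X] →ₗ[ℝ] EuclideanSpace ℝ (Fin d) where
  toFun p := WithLp.toLp 2 fun i => p.coeff i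
  map_add' p q := by ext i; simp
  map_smul' c p := by ext i; simp

theorem norm_coeffVec_sq (d : ℕ) (p : ℝ[X]) :
    ‖coeffVec d p‖ ^ 2 = ∑ i ∈ Finset.range d, p.coeff i ^ 2 := by
  rw [EuclideanSpace.real_norm_sq_eq, Finset.sum_range]
  rfl

theorem norm_coeffVec_X_mul_le (d : ℕ) (p : ℝ[X]) :
    ‖coeffVec d (X * p)‖ ≤ ‖coeffVec d p‖ := by
  refine le_of_sq_le_sq ?_ (norm_nonneg _)
  rw [norm_coeffVec_sq, norm_coeffVec_sq]
  cases d with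
  | zero => simp
  | succ d =>
    rw [Finset.sum_range_succ', Finset.sum_range_succ]
    simp only [coeff_X_mul, coeff_X_mul_zero]
    nlinarith [sq_nonneg (p.coeff d)]

theorem abs_coeff_le_norm_coeffVec (p : ℝ[X]) (k : ℕ) : |p.coeff k| ≤ ‖coeffVec (k + 1) p‖ := by
  refine abs_le_of_sq_le_sq ?_ (norm_nonneg _)
  rw [norm_coeffVec_sq, Finset.sum_range_succ]
  linarith [Finset.sum_nonneg fun i (_ : i ∈ Finset.range k) => sq_nonneg (p.coeff i)]

/-- The even polynomial with value `1` at the origin and zeros `± x k`, `k < n`. -/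
noncomputable def nodePoly (x : ℕ → ℝ) (n : ℕ) : ℝ[X] :=
  ∏ k ∈ Finset.range n, (1 - C ((x k ^ 2)⁻¹) * X ^ 2)

variable (x : ℕ → ℝ)

theorem nodePoly_zero : nodePoly x 0 = 1 := by simp [nodePoly]

theorem nodePoly_succ (n : ℕ) :
    nodePoly x (n + 1) = nodePoly x n * (1 - C ((x n ^ 2)⁻¹) * X ^ 2) :=
  Finset.prod_range_succ _ _

theorem nodePoly_eval (n : ℕ) (y : ℝ) :
    (nodePoly x n).eval y = ∏ k ∈ Finset.range n, (1 - (x k ^ 2)⁻¹ * y ^ 2) := by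
  simp [nodePoly, eval_prod]

theorem nodePoly_eval_neg (n : ℕ) (y : ℝ) :
    (nodePoly x n).eval (-y) = (nodePoly x n).eval y := by
  simp [nodePoly_eval]

theorem nodePoly_coeff_zero (n : ℕ) : (nodePoly x n).coeff 0 = 1 := by
  rw [coeff_zero_eq_eval_zero, nodePoly_eval]; simp

theorem nodePoly_ne_zero (n : ℕ) : nodePoly x n ≠ 0 := fun h => by
  simpa [h] using nodePoly_coeff_zero x n

theorem nodePoly_eval_node {x : ℕ → ℝ} {n k : ℕ} (hk : k < n) (hx : x k ≠ 0) :
    (nodePoly x n).eval (x k) = 0 := by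
  rw [nodePoly_eval]
  refine Finset.prod_eq_zero (Finset.mem_range.2 hk) ?_
  rw [inv_mul_cancel₀ (pow_ne_zero 2 hx), sub_self]

theorem degree_nodePoly {x : ℕ → ℝ} {n : ℕ} (hx : ∀ k < n, x k ≠ 0) :
    (nodePoly x n).degree = (2 * n : ℕ) := by
  rw [nodePoly, degree_prod, Finset.sum_congr rfl (g := fun _ => (2 : WithBot ℕ))]
  · simp [mul_comm]
  · intro k hk
    have h0 : (x k ^ 2)⁻¹ ≠ 0 := inv_ne_zero (pow_ne_zero 2 (hx k (Finset.mem_range.1 hk)))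
    rw [degree_sub_eq_right_of_degree_lt] <;> rw [degree_C_mul_X_pow 2 h0]
    · rfl
    · rw [degree_one]; decide

theorem nodePoly_congr {x y : ℕ → ℝ} {n : ℕ} (h : ∀ k < n, x k = y k) :
    nodePoly x n = nodePoly y n :=
  Finset.prod_congr rfl fun k hk => by rw [h k (Finset.mem_range.1 hk)]

/-- The constant `c` is the value at `X ^ 2 = -1`, a product of factors `1 + 1 / x k ^ 2`. -/
theorem nodePoly_eq_C_add (n : ℕ) :
    ∃ (T : ℝ[X]) (c : ℝ), 1 ≤ c ∧ nodePoly x n = C c + (1 + X ^ 2) * T := by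
  induction n with
  | zero => exact ⟨0, 1, le_rfl, by simp [nodePoly_zero]⟩
  | succ n ih =>
    obtain ⟨T, c, hc, h⟩ := ih
    set r := (x n ^ 2)⁻¹
    have hr : 0 ≤ r := by positivity
    refine ⟨T * (1 - C r * X ^ 2) - C (c * r), c * (1 + r), by nlinarith, ?_⟩
    rw [nodePoly_succ, h]
    simp only [C_mul, C_add, C_1]
    ring

theorem norm_coeffVec_nodePoly_succ_le {n : ℕ} {B : ℝ}
    (hB : ∀ d, ‖coeffVec d (nodePoly x n)‖ ≤ B) (d : ℕ) :
    ‖coeffVec d (nodePoly x (n + 1))‖ ≤ B * (1 + (x n ^ 2)⁻¹) := by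
  have h : nodePoly x (n + 1) = nodePoly x n - (x n ^ 2)⁻¹ • (X * (X * nodePoly x n)) := by
    rw [nodePoly_succ, smul_eq_C_mul]; ring
  have h2 := ((norm_coeffVec_X_mul_le d _).trans (norm_coeffVec_X_mul_le d _)).trans (hB d)
  have hr : 0 ≤ (x n ^ 2)⁻¹ := by positivity
  rw [h, map_sub, map_smul]
  refine (norm_sub_le _ _).trans ?_
  rw [norm_smul, Real.norm_of_nonneg hr]
  nlinarith [hB d, mul_le_mul_of_nonneg_left h2 hr]

variable (ε : ℕ → ℝ)

/-- The mass at the nodes `± x n`. -/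
noncomputable def nodeWeight (n : ℕ) : ℝ := ε n / (nodePoly x n).eval (x n) ^ 2

/-- The integral of `p ^ 2` with respect to the masses at the first `n` pairs of nodes. -/
noncomputable def nodeEnergy (n : ℕ) (p : ℝ[X]) : ℝ :=
  ∑ k ∈ Finset.range n, nodeWeight x ε k * (p.eval (x k) ^ 2 + p.eval (-x k) ^ 2)

variable {x ε}

theorem nodeWeight_nonneg (hε : ∀ n, 0 < ε n) (n : ℕ) : 0 ≤ nodeWeight x ε n :=
  div_nonneg (hε n).le (sq_nonneg _)

theorem nodeEnergy_nonneg (hε : ∀ n, 0 < ε n) (n : ℕ) (p : ℝ[X]) : 0 ≤ nodeEnergy x ε n p :=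
  Finset.sum_nonneg fun k _ => mul_nonneg (nodeWeight_nonneg hε k) (by positivity)

theorem nodeWeight_congr {y : ℕ → ℝ} {n : ℕ} (h : ∀ k ≤ n, x k = y k) :
    nodeWeight x ε n = nodeWeight y ε n := by
  rw [nodeWeight, nodeWeight, nodePoly_congr fun k hk => h k hk.le, h n le_rfl]

theorem nodeEnergy_congr {y : ℕ → ℝ} {n : ℕ} (h : ∀ k < n, x k = y k) (p : ℝ[X]) :
    nodeEnergy x ε n p = nodeEnergy y ε n p :=
  Finset.sum_congr rfl fun k hk => by
    have hk := Finset.mem_range.1 hk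
    rw [nodeWeight_congr fun j hj => h j (hj.trans_lt hk), h k hk]

/-- Lets the energy of `p` on the old nodes be computed from its remainder modulo `nodePoly x n`. -/
theorem nodeEnergy_add_mul {n : ℕ} (hx : ∀ k < n, x k ≠ 0) (q r : ℝ[X]) :
    nodeEnergy x ε n (q + r * nodePoly x n) = nodeEnergy x ε n q :=
  Finset.sum_congr rfl fun k hk => by
    have hk := Finset.mem_range.1 hk
    simp [nodePoly_eval_neg, nodePoly_eval_node hk (hx k hk)]

theorem abs_eval_le_of_abs_coeff_le {q : ℝ[X]} {d : ℕ} {ρ : ℝ} (hd : q.degree < (d : ℕ))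
    (hρ : ∀ k, |q.coeff k| ≤ ρ) {y : ℝ} (hy : 1 ≤ |y|) : |q.eval y| ≤ ρ * (d * |y| ^ (d - 1)) := by
  rcases eq_or_ne q 0 with rfl | hq
  · have : 0 ≤ ρ := (abs_nonneg _).trans (hρ 0)
    simp; positivity
  have hd' : q.natDegree < d := (natDegree_lt_iff_degree_lt hq).2 hd
  rw [eval_eq_sum_range' hd']
  refine (Finset.abs_sum_le_sum_abs _ _).trans ?_
  have : ∀ k ∈ Finset.range d, |q.coeff k * y ^ k| ≤ ρ * |y| ^ (d - 1) := fun k hk => by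
    rw [abs_mul, abs_pow]
    have := Finset.mem_range.1 hk
    exact mul_le_mul (hρ k) (pow_le_pow_right₀ hy (by omega)) (by positivity)
      ((abs_nonneg _).trans (hρ k))
  refine (Finset.sum_le_sum this).trans ?_
  rw [Finset.sum_const, Finset.card_range, nsmul_eq_mul]
  exact le_of_eq (by ring)

/-- A weighted Cauchy–Schwarz inequality. -/
theorem sq_add_le_of_weights {s t α β : ℝ} (hα : 0 < α) (hβ : 0 < β) :
    (s + t) ^ 2 ≤ (α + β) * (s ^ 2 / α + t ^ 2 / β) := by
  have : (α + β) * (s ^ 2 / α + t ^ 2 / β) - (s + t) ^ 2 = (β * s - α * t) ^ 2 / (α * β) := by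
    field_simp; ring
  have h2 : 0 ≤ (β * s - α * t) ^ 2 / (α * β) := by positivity
  linarith

/-- If the two values of `q + (a X + b) P` at `± y` are `P(y) U` and `P(y) V`, then its coefficients
are controlled by those of `q` and by `U`, `V`. -/
theorem norm_coeffVec_sq_le_of_pair {n d : ℕ} {p : ℝ[X]} {y e u u' E ρ : ℝ} (hy : 1 ≤ y)
    (he : 0 < e) (hu : 0 < u)
    (P q : ℝ[X]) (hP : P.eval y ≠ 0) (hPneg : P.eval (-y) = P.eval y) (a b : ℝ)
    (hp : p = q + (C a * X + C b) * P) (hPd : ‖coeffVec d P‖ ≤ 2) (hq : q.degree < (2 * n : ℕ))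
    (hρ : ∀ d, ‖coeffVec d q‖ ≤ ρ) (hE : ρ ^ 2 = u * E) {η : ℝ}
    (hη : (2 * n : ℕ) * y ^ (2 * n - 1) / |P.eval y| ≤ η)
    (hu' : (1 + 4 * η) ^ 2 * u + 4 / e ≤ u') :
    ‖coeffVec d p‖ ^ 2 ≤
      u' * (E + e / P.eval y ^ 2 * (p.eval y ^ 2 + p.eval (-y) ^ 2)) := by
  have hρ0 : 0 ≤ ρ := (norm_nonneg _).trans (hρ 0)
  have hη0 : 0 ≤ η := le_trans (by positivity) hη
  have hP0 : 0 < |P.eval y| := abs_pos.2 hP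
  have hqc : ∀ k, |q.coeff k| ≤ ρ := fun k => (abs_coeff_le_norm_coeffVec q k).trans (hρ _)
  -- Since `deg q < deg P` in the application, `q` is negligible against `P` at a distant node; `η`
  -- measures this.
  have hqe : ∀ z, |z| = y → |q.eval z / P.eval y| ≤ η * ρ := fun z hz => by
    rw [abs_div, div_le_iff₀ hP0]
    refine (abs_eval_le_of_abs_coeff_le hq hqc (by rw [hz]; exact hy)).trans ?_
    rw [hz]
    rw [div_le_iff₀ hP0] at hη
    nlinarith [mul_le_mul_of_nonneg_left hη hρ0]
  set r := q.eval y / P.eval y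
  set s := q.eval (-y) / P.eval y
  have hr : |r| ≤ η * ρ := hqe y (abs_of_nonneg (by linarith))
  have hs : |s| ≤ η * ρ := hqe (-y) (by rw [abs_neg, abs_of_nonneg (by linarith)])
  set U := p.eval y / P.eval y
  set V := p.eval (-y) / P.eval y
  have hU : U = r + (a * y + b) := by
    simp only [U, r, hp, eval_add, eval_mul, eval_C, eval_X]; field_simp
  have hV : V = s + (-(a * y) + b) := by
    simp only [V, s, hp, eval_add, eval_mul, eval_C, eval_X, hPneg]; field_simp
  have hUV : e / P.eval y ^ 2 * (p.eval y ^ 2 + p.eval (-y) ^ 2) = e * (U ^ 2 + V ^ 2) := by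
    simp only [U, V]; field_simp
  -- Half the sum and half the difference of `U` and `V` isolate `b` and `a * y`, up to errors from
  -- `q`; `y ≥ 1` then bounds `a`.
  have hb : |b| ≤ |(U + V) / 2| + η * ρ := by
    have : b = (U + V) / 2 + (-(r + s) / 2) := by rw [hU, hV]; ring
    rw [this]
    refine (abs_add_le _ _).trans (add_le_add_right ?_ _)
    rw [abs_le] at hr hs ⊢
    constructor <;> linarith [hr.1, hr.2, hs.1, hs.2]
  have ha : |a| ≤ |(U - V) / 2| + η * ρ := by
    have h1 : a * y = (U - V) / 2 + ((s - r) / 2) := by rw [hU, hV]; ring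
    have h2 : |a| ≤ |a * y| := by
      rw [abs_mul, abs_of_nonneg (by linarith : (0 : ℝ) ≤ y)]
      exact le_mul_of_one_le_right (abs_nonneg _) hy
    refine h2.trans ?_
    rw [h1]
    refine (abs_add_le _ _).trans (add_le_add_right ?_ _)
    rw [abs_le] at hr hs ⊢
    constructor <;> linarith [hr.1, hr.2, hs.1, hs.2]
  have hnorm : ‖coeffVec d p‖ ≤
      (1 + 4 * η) * ρ + 2 * (|(U + V) / 2| + |(U - V) / 2|) := by
    have e1 : p = q + (a • (X * P) + b • P) := by
      rw [hp, smul_eq_C_mul, smul_eq_C_mul]; ring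
    rw [e1, map_add, map_add, map_smul, map_smul]
    have h1 := norm_add_le (coeffVec d q) (a • coeffVec d (X * P) + b • coeffVec d P)
    have h2 := norm_add_le (a • coeffVec d (X * P)) (b • coeffVec d P)
    rw [norm_smul, norm_smul, Real.norm_eq_abs, Real.norm_eq_abs] at h2
    have h3 := mul_le_mul_of_nonneg_left ((norm_coeffVec_X_mul_le d P).trans hPd) (abs_nonneg a)
    have h4 := mul_le_mul_of_nonneg_left hPd (abs_nonneg b)
    linarith [hρ d]
  set G := |(U + V) / 2|
  set H := |(U - V) / 2|
  have hGH : 2 * (G ^ 2 + H ^ 2) = U ^ 2 + V ^ 2 := by simp only [G, H, sq_abs]; ring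
  have hE0 : E = ρ ^ 2 / u := by rw [hE]; field_simp
  -- The weights are the two summands in `hu'`; they turn the two quotients into the old energy and
  -- at most the energy of the new pair.
  have hcs := sq_add_le_of_weights (s := (1 + 4 * η) * ρ) (t := 2 * (G + H))
    (α := (1 + 4 * η) ^ 2 * u) (β := 4 / e) (by positivity) (by positivity)
  have hs1 : ((1 + 4 * η) * ρ) ^ 2 / ((1 + 4 * η) ^ 2 * u) = E := by
    rw [hE0]; field_simp
  have hs2 : (2 * (G + H)) ^ 2 / (4 / e) ≤ e * (U ^ 2 + V ^ 2) := by
    rw [← hGH]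
    have : (2 * (G + H)) ^ 2 / (4 / e) = e * (G + H) ^ 2 := by field_simp; ring
    rw [this]
    exact mul_le_mul_of_nonneg_left (by nlinarith [sq_nonneg (G - H)]) he.le
  rw [hs1] at hcs
  have hE1 : 0 ≤ E := by rw [hE0]; positivity
  rw [hUV]
  calc _ ≤ _ := pow_le_pow_left₀ (norm_nonneg _) hnorm 2
    _ ≤ _ := hcs
    _ ≤ _ := mul_le_mul hu' (by linarith) (by positivity) (le_trans (by positivity) hu')

end Nodes

/-! ### Choosing a sequence term by term -/

section Recursion

/-- The sequence whose `n`-th term is computed by `F` from the terms before it. -/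
noncomputable def prefixRec (F : ℕ → (ℕ → ℝ) → ℝ) (n : ℕ) : ℝ :=
  F n fun k => if _h : k < n then prefixRec F k else 0
termination_by n

/-- A sequence can be chosen term by term when the `n`-th requirement concerns only the terms up to
`n` and can always be met by choosing the `n`-th term. -/
theorem exists_seq_of_forall_prefix (R : ℕ → (ℕ → ℝ) → Prop)
    (hcongr : ∀ n x y, (∀ k ≤ n, x k = y k) → R n x → R n y)
    (hstep : ∀ n x, (∀ k < n, R k x) → ∃ y, R n (Function.update x n y)) :
    ∃ x : ℕ → ℝ, ∀ n, R n x := by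
  classical
  set F : ℕ → (ℕ → ℝ) → ℝ := fun n x =>
    if h : ∃ y, R n (Function.update x n y) then h.choose else 0
  refine ⟨prefixRec F, fun n => ?_⟩
  induction n using Nat.strong_induction_on with
  | _ n ih =>
    -- The default value `0` is harmless: requirement `n` sees only indices up to `n`, and index `n`
    -- itself is overwritten.
    set z : ℕ → ℝ := fun k => if _h : k < n then prefixRec F k else 0
    have hz : ∀ k < n, z k = prefixRec F k := fun k hk => by simp [z, hk]
    have hex : ∃ y, R n (Function.update z n y) := hstep n z fun k hk =>
      hcongr k _ _ (fun j hj => (hz j (hj.trans_lt hk)).symm) (ih k hk)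
    have hn : prefixRec F n = hex.choose := by
      rw [prefixRec]
      exact dif_pos hex
    refine hcongr n _ _ (fun k hk => ?_) hex.choose_spec
    rcases hk.lt_or_eq with h | rfl
    · rw [Function.update_of_ne h.ne, hz k h]
    · rw [Function.update_self, hn]

end Recursion

/-! ### Inductive choice of the nodes -/

section NodeSelection

open Polynomial

/-- The requirements on the node `x n` in terms of the nodes before it. -/
structure IsGoodNode (u ε : ℕ → ℝ) (n : ℕ) (x : ℕ → ℝ) : Prop where
  one_le : 1 ≤ x n
  -- Telescoping bound that keeps every node polynomial's coefficient norm below `2`, starting from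
  -- norm `1`.
  norm_le : (2 - 1 / ((n : ℝ) + 1)) * (1 + (x n ^ 2)⁻¹) ≤ 2 - 1 / ((n : ℝ) + 2)
  energy_ge : ∀ p : ℝ[X], p.degree < (2 * (n + 1) : ℕ) → ∀ d,
    ‖coeffVec d p‖ ^ 2 ≤ u n * nodeEnergy x ε (n + 1) p
  -- Makes every moment converge geometrically.
  moment_le : 1 ≤ n → nodeWeight x ε n * x n ^ (2 * n) ≤ (1 / 4) ^ n
  -- Makes the mass of later nodes negligible in the integral of `(nodePoly x j) ^ 2`.
  tail_le : ∀ j < n, nodeWeight x ε n * (nodePoly x j).eval (x n) ^ 2 ≤ (1 / 4) ^ n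

variable {u ε x y : ℕ → ℝ} {n : ℕ}

theorem IsGoodNode.ne_zero (h : IsGoodNode u ε n x) : x n ≠ 0 := by linarith [h.one_le]

theorem IsGoodNode.congr (hxy : ∀ k ≤ n, x k = y k) (h : IsGoodNode u ε n x) :
    IsGoodNode u ε n y := by
  obtain ⟨h1, h2, h3, h4, h5⟩ := h
  have e1 := hxy n le_rfl
  have e2 : nodeWeight x ε n = nodeWeight y ε n := nodeWeight_congr hxy
  rw [e1] at h1 h2
  refine ⟨h1, h2, fun p hp d => ?_, fun hn => ?_, fun j hj => ?_⟩
  · rw [← nodeEnergy_congr fun k hk => hxy k (Nat.lt_succ_iff.1 hk)]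
    exact h3 p hp d
  · rw [← e2, ← e1]; exact h4 hn
  · rw [← e2, ← e1, ← nodePoly_congr fun k hk => hxy k (hk.le.trans hj.le)]; exact h5 j hj

theorem norm_coeffVec_nodePoly_le (h : ∀ k < n, IsGoodNode u ε k x) (d : ℕ) :
    ‖coeffVec d (nodePoly x n)‖ ≤ 2 - 1 / ((n : ℝ) + 1) := by
  induction n generalizing d with
  | zero =>
    refine abs_le_of_sq_le_sq' ?_ (by norm_num) |>.2
    rw [norm_coeffVec_sq, nodePoly_zero]
    simp only [coeff_one]
    norm_num [Finset.sum_ite_eq]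
    split_ifs <;> norm_num
  | succ n ih =>
    refine (norm_coeffVec_nodePoly_succ_le x (ih fun k hk => h k (by omega)) d).trans ?_
    refine (h n (by omega)).norm_le.trans (le_of_eq ?_)
    push_cast; ring

theorem tendsto_eval_div_eval_of_degree_lt {Q P : ℝ[X]} (h : Q.degree < P.degree) (c : ℝ) :
    Tendsto (fun y => c * (Q.eval y / P.eval y)) atTop (𝓝 0) := by
  simpa using (div_tendsto_atTop_zero_of_degree_lt Q P h).const_mul c

theorem isGoodNode_zero_two (hu : 1 ≤ u 0) (hε : ε 0 = 1 / 2) :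
    IsGoodNode u ε 0 fun _ => 2 where
  one_le := by norm_num
  norm_le := by norm_num
  moment_le h := by omega
  tail_le j hj := by omega
  -- Masses `1 / 2` at `± 2` give `a * X + b` the energy `4 * a ^ 2 + b ^ 2`, which dominates `a ^ 2
  -- + b ^ 2`.
  energy_ge p hp d := by
    have hp1 : p.natDegree ≤ 1 := by
      rcases eq_or_ne p 0 with rfl | hp0
      · simp
      have := (natDegree_lt_iff_degree_lt hp0).2 hp
      omega
    obtain ⟨a, b, rfl⟩ := exists_eq_X_add_C_of_natDegree_le_one hp1
    have h1 : ‖coeffVec d (C a * X + C b)‖ ^ 2 ≤ a ^ 2 + b ^ 2 := by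
      rw [norm_coeffVec_sq]
      calc _ ≤ ∑ i ∈ Finset.range (d + 2), (C a * X + C b).coeff i ^ 2 :=
            Finset.sum_le_sum_of_subset_of_nonneg (Finset.range_subset_range.2 (by omega))
              fun _ _ _ => sq_nonneg _
        _ = _ := by
            rw [Finset.sum_range_succ', Finset.sum_range_succ']
            simp [coeff_X, coeff_C]
    have h2 : nodeEnergy (fun _ => 2) ε (0 + 1) (C a * X + C b) = 4 * a ^ 2 + b ^ 2 := by
      simp [nodeEnergy, nodeWeight, nodePoly_zero, hε]
      ring
    rw [h2]
    nlinarith [sq_nonneg a, sq_nonneg b]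

/-- Reduces the choice of the next node to explicit inequalities in `y`. The energy bound comes from
dividing `p` by the node polynomial: the degree bound makes the quotient linear, and induction
controls the remainder. -/
theorem IsGoodNode.of_eval_bounds {z : ℕ → ℝ} (hε : ∀ n, 0 < ε n) (hu : ∀ n, 0 < u n)
    (h : ∀ k < n + 1, IsGoodNode u ε k x) (hz : ∀ k < n + 1, x k = z k) {y : ℝ}
    (hy : z (n + 1) = y) (h1 : 1 ≤ y)
    (h2 : (2 - 1 / (((n + 1 : ℕ) : ℝ) + 1)) * (1 + (y ^ 2)⁻¹) ≤ 2 - 1 / (((n + 1 : ℕ) : ℝ) + 2))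
    (h3 : (nodePoly x (n + 1)).eval y ≠ 0)
    (h4 : (1 + 4 * ((2 * (n + 1) : ℕ) * y ^ (2 * (n + 1) - 1) /
      |(nodePoly x (n + 1)).eval y|)) ^ 2 * u n + 4 / ε (n + 1) ≤ u (n + 1))
    (h5 : ε (n + 1) / (nodePoly x (n + 1)).eval y ^ 2 * y ^ (2 * (n + 1)) ≤ (1 / 4) ^ (n + 1))
    (h6 : ∀ j < n + 1, ε (n + 1) / (nodePoly x (n + 1)).eval y ^ 2 *
      (nodePoly x j).eval y ^ 2 ≤ (1 / 4) ^ (n + 1)) :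
    IsGoodNode u ε (n + 1) z := by
  have hP : nodePoly x (n + 1) = nodePoly z (n + 1) := nodePoly_congr hz
  have hw : nodeWeight z ε (n + 1) = ε (n + 1) / (nodePoly x (n + 1)).eval y ^ 2 := by
    rw [nodeWeight, ← hP, hy]
  refine ⟨hy ▸ h1, hy ▸ h2, fun p hp d => ?_, fun _ => ?_, fun j hj => ?_⟩
  · have hx : ∀ k < n + 1, x k ≠ 0 := fun k hk => (h k hk).ne_zero
    set P := nodePoly x (n + 1)
    have hdeg : P.degree = (2 * (n + 1) : ℕ) := degree_nodePoly hx
    have hP0 : P ≠ 0 := nodePoly_ne_zero _ _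
    have hr : (p / P).natDegree ≤ 1 := by
      by_cases hpP : p / P = 0
      · simp [hpP]
      have hp0 : p ≠ 0 := fun h0 => hpP (by simp [h0])
      have hle : P.degree ≤ p.degree := not_lt.1 fun hlt => hpP ((Polynomial.div_eq_zero_iff hP0).2 hlt)
      have e3 := degree_add_div hP0 hle
      rw [degree_eq_natDegree hP0, degree_eq_natDegree hpP, degree_eq_natDegree hp0] at e3
      have e3 : P.natDegree + (p / P).natDegree = p.natDegree := by exact_mod_cast e3
      have e1 := natDegree_eq_of_degree_eq_some hdeg
      have e2 := (natDegree_lt_iff_degree_lt hp0).2 hp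
      omega
    obtain ⟨a, b, hab⟩ := exists_eq_X_add_C_of_natDegree_le_one hr
    have hdiv : p = p % P + (C a * X + C b) * P := by
      rw [← hab, mul_comm]; exact (EuclideanDomain.mod_add_div p P).symm
    have hq : (p % P).degree < (2 * (n + 1) : ℕ) := hdeg ▸ degree_mod_lt p hP0
    have hen : nodeEnergy x ε (n + 1) p = nodeEnergy x ε (n + 1) (p % P) := by
      conv_lhs => rw [hdiv]
      exact nodeEnergy_add_mul hx _ _
    have hE0 := nodeEnergy_nonneg (x := x) hε (n + 1) (p % P)
    have hPd : ‖coeffVec d P‖ ≤ 2 := (norm_coeffVec_nodePoly_le h d).trans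
      (sub_le_self _ (by positivity))
    have hsplit : nodeEnergy z ε (n + 1 + 1) p = nodeEnergy x ε (n + 1) (p % P)
        + ε (n + 1) / P.eval y ^ 2 * (p.eval y ^ 2 + p.eval (-y) ^ 2) := by
      rw [nodeEnergy, Finset.sum_range_succ, ← hen, nodeEnergy_congr hz, hw, hy]
      rfl
    rw [hsplit]
    refine norm_coeffVec_sq_le_of_pair (n := n + 1) (u := u n) h1 (hε _) (hu _) P (p % P) h3
      (nodePoly_eval_neg _ _ _) a b hdiv hPd hq
      (ρ := √(u n * nodeEnergy x ε (n + 1) (p % P))) (fun d' => ?_)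
      (Real.sq_sqrt (mul_nonneg (hu _).le hE0)) le_rfl h4
    exact Real.le_sqrt_of_sq_le ((h n (by omega)).energy_ge _ hq d')
  · rw [hw, hy]; exact h5
  · rw [hw, hy, ← nodePoly_congr fun k hk => hz k (hk.trans hj)]
    exact h6 j hj

/-- Each requirement holds for all large `y`, by comparison of degrees and limits. -/
theorem exists_isGoodNode_succ (hε : ∀ n, 0 < ε n) (hu : ∀ n, 0 < u n)
    (hlt : u n + 4 / ε (n + 1) < u (n + 1)) (h : ∀ k < n + 1, IsGoodNode u ε k x) :
    ∃ y, IsGoodNode u ε (n + 1) (Function.update x (n + 1) y) := by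
  have hx : ∀ k < n + 1, x k ≠ 0 := fun k hk => (h k hk).ne_zero
  set P := nodePoly x (n + 1)
  have hdeg : P.degree = (2 * (n + 1) : ℕ) := degree_nodePoly hx
  have hdeg2 : (P ^ 2).degree = (4 * (n + 1) : ℕ) := by
    rw [degree_pow, hdeg, nsmul_eq_mul]; norm_cast; ring
  have c4 : (0 : ℝ) < (1 / 4) ^ (n + 1) := by positivity
  have e1 : ∀ᶠ y : ℝ in atTop, 1 ≤ y := eventually_ge_atTop 1
  have e2 : ∀ᶠ y : ℝ in atTop, (2 - 1 / (((n + 1 : ℕ) : ℝ) + 1)) * (1 + (y ^ 2)⁻¹)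
      ≤ 2 - 1 / (((n + 1 : ℕ) : ℝ) + 2) := by
    have ht : Tendsto (fun y : ℝ => (2 - 1 / (((n + 1 : ℕ) : ℝ) + 1)) * (1 + (y ^ 2)⁻¹)) atTop
        (𝓝 ((2 - 1 / (((n + 1 : ℕ) : ℝ) + 1)) * (1 + 0))) :=
      ((tendsto_inv_atTop_zero.comp (tendsto_pow_atTop two_ne_zero)).const_add 1).const_mul _
    refine (ht.eventually_lt_const ?_).mono fun y hy => hy.le
    rw [add_zero, mul_one]
    exact sub_lt_sub_left (one_div_lt_one_div_of_lt (by positivity) (by linarith)) _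
  have e3 : ∀ᶠ y : ℝ in atTop, P.eval y ≠ 0 := eventually_atTop_not_isRoot P (nodePoly_ne_zero _ _)
  -- The left side tends to `u n + 4 / ε (n + 1)`, so the strict inequality `hlt` leaves room.
  have e4 : ∀ᶠ y : ℝ in atTop, (1 + 4 * ((2 * (n + 1) : ℕ) * y ^ (2 * (n + 1) - 1) /
      |P.eval y|)) ^ 2 * u n + 4 / ε (n + 1) ≤ u (n + 1) := by
    have hd : (X ^ (2 * (n + 1) - 1) : ℝ[X]).degree < P.degree := by
      rw [hdeg, degree_X_pow]; exact_mod_cast (by omega)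
    have ht := (tendsto_eval_div_eval_of_degree_lt hd ((2 * (n + 1) : ℕ) : ℝ)).abs
    have ht2 := (((((ht.const_mul 4).const_add 1).pow 2).mul_const (u n)).add_const
      (4 / ε (n + 1))).eventually_lt_const (u := u (n + 1)) (by simpa using hlt)
    filter_upwards [ht2, e1] with y hy hy1
    refine le_of_eq_of_le ?_ hy.le
    rw [eval_pow, eval_X, abs_mul, abs_div, Nat.abs_cast,
      abs_of_nonneg (pow_nonneg (by linarith : (0 : ℝ) ≤ y) _), mul_div_assoc]
  have e5 : ∀ᶠ y : ℝ in atTop, ε (n + 1) / P.eval y ^ 2 * y ^ (2 * (n + 1))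
      ≤ (1 / 4) ^ (n + 1) := by
    have hd : (X ^ (2 * (n + 1)) : ℝ[X]).degree < (P ^ 2).degree := by
      rw [hdeg2, degree_X_pow]; exact_mod_cast (by omega)
    filter_upwards [(tendsto_eval_div_eval_of_degree_lt hd (ε (n + 1))).eventually_lt_const c4]
      with y hy
    refine le_of_eq_of_le ?_ hy.le
    rw [eval_pow, eval_X, eval_pow]; ring
  have e6 : ∀ᶠ y : ℝ in atTop, ∀ j ∈ Finset.range (n + 1), ε (n + 1) / P.eval y ^ 2 *
      (nodePoly x j).eval y ^ 2 ≤ (1 / 4) ^ (n + 1) := by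
    rw [Filter.eventually_all_finset]
    intro j hj
    have hj := Finset.mem_range.1 hj
    have hd : (nodePoly x j ^ 2).degree < (P ^ 2).degree := by
      rw [hdeg2, degree_pow, degree_nodePoly fun k hk => hx k (hk.trans hj), nsmul_eq_mul]
      exact_mod_cast (by omega)
    filter_upwards [(tendsto_eval_div_eval_of_degree_lt hd (ε (n + 1))).eventually_lt_const c4]
      with y hy
    refine le_of_eq_of_le ?_ hy.le
    rw [eval_pow, eval_pow]; ring
  obtain ⟨y, h1, h2, h3, h4, h5, h6⟩ :=
    (e1.and (e2.and (e3.and (e4.and (e5.and e6))))).exists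
  exact ⟨y, .of_eval_bounds hε hu h
    (fun k hk => (Function.update_of_ne hk.ne _ _).symm) (Function.update_self _ _ _) h1 h2 h3 h4 h5
    fun j hj => h6 j (Finset.mem_range.2 hj)⟩

theorem exists_nodes (hε : ∀ n, 0 < ε n) (hu : ∀ n, 0 < u n) (hu0 : 1 ≤ u 0) (hε0 : ε 0 = 1 / 2)
    (hlt : ∀ n, u n + 4 / ε (n + 1) < u (n + 1)) : ∃ x : ℕ → ℝ, ∀ n, IsGoodNode u ε n x := by
  refine exists_seq_of_forall_prefix (IsGoodNode u ε) (fun n x y hxy h => h.congr hxy)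
    fun n x h => ?_
  cases n with
  | zero =>
    refine ⟨2, (isGoodNode_zero_two hu0 hε0).congr fun k hk => ?_⟩
    rw [Nat.le_zero.1 hk, Function.update_self]
  | succ n => exact exists_isGoodNode_succ hε hu (hlt n) h

end NodeSelection

/-! ### Slowly growing sequences with large jumps -/

section Scales

/-- Below a monotone sequence tending to infinity and exceeding `1` there is a strictly increasing
positive sequence with unbounded increments. -/
theorem exists_strictMono_unbounded_increments {t : ℕ → ℝ} (ht : Monotone t)
    (hlim : Tendsto t atTop atTop) (h0 : 1 < t 0) :
    ∃ u : ℕ → ℝ, u 0 = 1 ∧ StrictMono u ∧ (∀ n, u n ≤ t n) ∧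
      ∀ B : ℝ, ∃ n, B ≤ u (n + 1) - u n := by
  set κ := t 0
  -- The sequence is `D n ^ 2 * w n`. Gaps between consecutive squares give unbounded increments
  -- however rarely `D` jumps; `w`, rising from `1` and bounded by `κ`, gives strict growth between
  -- jumps. The cap `n + 1` forces `D 0 = 1`.
  set D : ℕ → ℕ := fun n => Nat.findGreatest (fun D => (D : ℝ) ^ 2 * κ ≤ t n) (n + 1)
  have hD1 : ∀ n, 1 ≤ D n := fun n =>
    Nat.le_findGreatest (by omega) (by simpa using ht (Nat.zero_le n))
  have hDt : ∀ n, (D n : ℝ) ^ 2 * κ ≤ t n := fun n =>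
    Nat.findGreatest_spec (P := fun D : ℕ => (D : ℝ) ^ 2 * κ ≤ t n) (m := 1) (by omega)
      (by simpa using ht (Nat.zero_le n))
  have hDmono : Monotone D := monotone_nat_of_le_succ fun n =>
    Nat.le_findGreatest (Nat.findGreatest_le _ |>.trans (by omega)) ((hDt n).trans (ht (by omega)))
  have hDlim : ∀ B : ℕ, ∃ n, B ≤ D n := fun B => by
    obtain ⟨n, hn, hnB⟩ := ((hlim.eventually_ge_atTop ((B : ℝ) ^ 2 * κ)).and
      (eventually_ge_atTop B)).exists
    exact ⟨n, Nat.le_findGreatest (by omega) hn⟩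
  set w : ℕ → ℝ := fun n => κ - (κ - 1) / (n + 1)
  have hw : StrictMono w := strictMono_nat_of_lt_succ fun n => by
    refine sub_lt_sub_left (div_lt_div_of_pos_left (by linarith) (by positivity) ?_) _
    push_cast; linarith
  have hw0 : w 0 = 1 := by simp [w]
  have hw1 : ∀ n, 1 ≤ w n := fun n => hw0 ▸ hw.monotone (Nat.zero_le n)
  have hwκ : ∀ n, w n ≤ κ := fun n =>
    sub_le_self _ (div_nonneg (by linarith) (by positivity))
  have hD0 : D 0 = 1 := le_antisymm (Nat.findGreatest_le _) (hD1 0)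
  have hD1' : ∀ n, (1 : ℝ) ≤ D n := fun n => by exact_mod_cast hD1 n
  refine ⟨fun n => (D n : ℝ) ^ 2 * w n, by simp [hD0, hw0], strictMono_nat_of_lt_succ fun n => ?_,
    fun n => ?_, fun B => ?_⟩
  · have h1 : (D n : ℝ) ≤ D (n + 1) := by exact_mod_cast hDmono (Nat.le_succ n)
    have h2 : w n < w (n + 1) := hw (Nat.lt_succ_self n)
    have h3 := hD1' n
    exact mul_lt_mul' (pow_le_pow_left₀ (by linarith) h1 2) h2 (by linarith [hw1 n])
      (by have := hD1' (n + 1); positivity)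
  · exact (mul_le_mul_of_nonneg_left (hwκ n) (sq_nonneg _)).trans (hDt n)
  · obtain ⟨b, hb⟩ := exists_nat_ge B
    have hex : ∃ n, b + 2 ≤ D n := hDlim (b + 2)
    classical
    -- At the first index where `D` reaches `b + 2` it has just jumped, so its square grows by at
    -- least `2 * (b + 2) - 1`, which exceeds `B`.
    obtain ⟨m, hm⟩ : ∃ m, Nat.find hex = m + 1 := Nat.exists_eq_succ_of_ne_zero fun h => by
      have := Nat.find_spec hex
      rw [h, hD0] at this
      omega
    refine ⟨m, ?_⟩
    have h1 : b + 2 ≤ D (m + 1) := hm ▸ Nat.find_spec hex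
    have h2 : D m < D (m + 1) := by
      have := Nat.find_min hex (m := m) (by omega)
      omega
    have h1' : (b : ℝ) + 2 ≤ D (m + 1) := by exact_mod_cast h1
    have h2' : (D m : ℝ) + 1 ≤ D (m + 1) := by exact_mod_cast h2
    have h3 : w m ≤ w (m + 1) := hw.monotone (Nat.le_succ m)
    have h4 := hw1 m
    have h5 := hD1' m
    have h6 : (D m : ℝ) ^ 2 + B ≤ (D (m + 1) : ℝ) ^ 2 := by nlinarith
    have h7 : (D (m + 1) : ℝ) ^ 2 * w m ≤ (D (m + 1) : ℝ) ^ 2 * w (m + 1) :=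
      mul_le_mul_of_nonneg_left h3 (sq_nonneg _)
    have h8 : (0 : ℝ) ≤ (D (m + 1) : ℝ) ^ 2 - (D m : ℝ) ^ 2 := by nlinarith
    have h9 := mul_le_mul_of_nonneg_left h4 h8
    simp only
    linarith

end Scales

/-! ### Symmetric discrete measures -/

section SymmetricSum

/-- The measure with masses `m k` at each of the two points `± x k`. -/
noncomputable def symmetricSum (m x : ℕ → ℝ) : Measure ℝ :=
  Measure.sum fun k => ENNReal.ofReal (m k) • (Measure.dirac (x k) + Measure.dirac (-x k))

variable {m x : ℕ → ℝ}

theorem integrable_symmetricPair (f : ℝ → ℝ) (k : ℕ) :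
    Integrable f (ENNReal.ofReal (m k) • (Measure.dirac (x k) + Measure.dirac (-x k))) :=
  ((integrable_dirac (by simp)).add_measure (integrable_dirac (by simp))).smul_measure
    ENNReal.ofReal_ne_top

theorem integral_symmetricPair (hm : ∀ k, 0 ≤ m k) (f : ℝ → ℝ) (k : ℕ) :
    ∫ y, f y ∂(ENNReal.ofReal (m k) • (Measure.dirac (x k) + Measure.dirac (-x k)))
      = m k * (f (x k) + f (-x k)) := by
  rw [integral_smul_measure, integral_add_measure (integrable_dirac (by simp))
    (integrable_dirac (by simp)), integral_dirac, integral_dirac, ENNReal.toReal_ofReal (hm k),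
    smul_eq_mul]

theorem integrable_symmetricSum (hm : ∀ k, 0 ≤ m k) {f : ℝ → ℝ}
    (h : Summable fun k => m k * (|f (x k)| + |f (-x k)|)) : Integrable f (symmetricSum m x) := by
  refine integrable_sum_measure (fun k => integrable_symmetricPair f k) (h.congr fun k => ?_)
  rw [integral_symmetricPair hm fun y => ‖f y‖]
  simp only [Real.norm_eq_abs]

theorem hasSum_integral_symmetricSum (hm : ∀ k, 0 ≤ m k) {f : ℝ → ℝ}
    (hf : Integrable f (symmetricSum m x)) :
    HasSum (fun k => m k * (f (x k) + f (-x k))) (∫ y, f y ∂symmetricSum m x) := by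
  have h := hasSum_integral_measure hf
  simp only [integral_symmetricPair hm] at h
  exact h

theorem map_neg_symmetricSum : (symmetricSum m x).map Neg.neg = symmetricSum m x := by
  rw [symmetricSum, Measure.map_sum measurable_neg.aemeasurable]
  congr 1
  funext k
  rw [Measure.map_smul, Measure.map_add _ _ measurable_neg, Measure.map_dirac' measurable_neg,
    Measure.map_dirac' measurable_neg, neg_neg, add_comm]

end SymmetricSum

/-! ### Moments, energy and mass of the node measure -/

section NodeMeasure

open Polynomial

variable {u ε x : ℕ → ℝ}

theorem IsGoodNode.weight_mul_pow_le {n j : ℕ} (hε : ∀ n, 0 < ε n) (h : IsGoodNode u ε n x)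
    (hn : 1 ≤ n) (hj : j ≤ 2 * n) : nodeWeight x ε n * x n ^ j ≤ (1 / 4) ^ n :=
  (mul_le_mul_of_nonneg_left (pow_le_pow_right₀ h.one_le hj) (nodeWeight_nonneg hε n)).trans
    (h.moment_le hn)

theorem hasAllMoments_symmetricSum (hε : ∀ n, 0 < ε n) (h : ∀ n, IsGoodNode u ε n x) :
    HasAllMoments (symmetricSum (nodeWeight x ε) x) := fun j => by
  refine integrable_symmetricSum (nodeWeight_nonneg hε) ?_
  have hg : Summable fun n : ℕ => 2 * (1 / 4 : ℝ) ^ n :=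
    (summable_geometric_of_lt_one (by norm_num) (by norm_num)).mul_left 2
  refine Summable.of_norm_bounded_eventually_nat hg ?_
  filter_upwards [eventually_ge_atTop (j + 1)] with n hn
  have h1 := (h n).one_le
  have h2 := (h n).weight_mul_pow_le hε (j := j) (by omega) (by omega)
  rw [Real.norm_of_nonneg (mul_nonneg (nodeWeight_nonneg hε n) (by positivity)), abs_pow, abs_pow,
    abs_neg, abs_of_nonneg (by linarith : 0 ≤ x n)]
  linarith

theorem nodeEnergy_le_integral (hε : ∀ n, 0 < ε n) (h : ∀ n, IsGoodNode u ε n x) (n : ℕ)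
    (p : ℝ[X]) :
    nodeEnergy x ε n p ≤ ∫ y, p.eval y ^ 2 ∂symmetricSum (nodeWeight x ε) x :=
  sum_le_hasSum _ (fun k _ => mul_nonneg (nodeWeight_nonneg hε k) (by positivity))
    (hasSum_integral_symmetricSum (nodeWeight_nonneg hε)
      ((hasAllMoments_symmetricSum hε h).integrable_eval_sq p))

/-- Earlier nodes are zeros, the pair `± x n` contributes at most `2 * ε n` by the choice of mass,
and `tail_le` bounds the rest by a geometric series. -/
theorem integral_nodePoly_sq_le (hε : ∀ n, 0 < ε n) (h : ∀ n, IsGoodNode u ε n x) (n : ℕ) :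
    ∫ y, (nodePoly x n).eval y ^ 2 ∂symmetricSum (nodeWeight x ε) x
      ≤ 2 * ε n + 4 * (1 / 2) ^ n := by
  have hw := nodeWeight_nonneg (x := x) hε
  have h1 := hasSum_integral_symmetricSum hw
    ((hasAllMoments_symmetricSum hε h).integrable_eval_sq (nodePoly x n))
  have h2 : HasSum (fun k => (if k = n then 2 * ε n else 0) + 2 * (1 / 2) ^ n * (1 / 2 : ℝ) ^ k)
      (2 * ε n + 2 * (1 / 2) ^ n * 2) :=
    (hasSum_ite_eq n (2 * ε n)).add (hasSum_geometric_two.mul_left _)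
  refine (hasSum_le (fun k => ?_) h1 h2).trans (le_of_eq (by ring))
  rw [nodePoly_eval_neg, ← two_mul]
  rcases lt_trichotomy k n with hk | rfl | hk
  · rw [nodePoly_eval_node hk (h k).ne_zero, if_neg hk.ne]
    simp
  · rw [if_pos rfl]
    have h3 : nodeWeight x ε k * (nodePoly x k).eval (x k) ^ 2 ≤ ε k := by
      rw [nodeWeight]
      rcases eq_or_ne ((nodePoly x k).eval (x k)) 0 with h0 | h0
      · rw [h0]; simpa using (hε k).le
      · rw [div_mul_cancel₀ _ (pow_ne_zero 2 h0)]
    have h4 : (0 : ℝ) ≤ 2 * (1 / 2) ^ k * (1 / 2) ^ k := by positivity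
    linarith
  · rw [if_neg hk.ne']
    have h3 := (h k).tail_le n hk
    have h4 : (1 / 4 : ℝ) ^ k ≤ (1 / 2) ^ n * (1 / 2) ^ k := by
      have : (1 / 4 : ℝ) ^ k = (1 / 2) ^ k * (1 / 2) ^ k := by rw [← mul_pow]; norm_num
      rw [this]
      exact mul_le_mul_of_nonneg_right
        (pow_le_pow_of_le_one (by norm_num) (by norm_num) hk.le) (by positivity)
    linarith

/-- The first pair alone has mass `1`; the remaining pairs are dominated by a geometric series. -/
theorem integral_one_nodeMeasure (hε : ∀ n, 0 < ε n) (hε0 : ε 0 = 1 / 2)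
    (h : ∀ n, IsGoodNode u ε n x) :
    1 ≤ ∫ _, (1 : ℝ) ∂symmetricSum (nodeWeight x ε) x ∧
      ∫ _, (1 : ℝ) ∂symmetricSum (nodeWeight x ε) x ≤ 2 := by
  have hw := nodeWeight_nonneg (x := x) hε
  have hint : Integrable (fun _ => (1 : ℝ)) (symmetricSum (nodeWeight x ε) x) := by
    simpa using hasAllMoments_symmetricSum hε h 0
  have h1 := hasSum_integral_symmetricSum hw hint
  have h0 : nodeWeight x ε 0 = 1 / 2 := by simp [nodeWeight, nodePoly_zero, hε0]
  constructor
  · have := le_hasSum h1 0 fun k _ => mul_nonneg (hw k) (by norm_num)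
    rw [h0] at this
    linarith
  · refine hasSum_le (fun k => ?_) h1 hasSum_geometric_two
    cases k with
    | zero => rw [h0]; norm_num
    | succ k =>
      have h2 := (h (k + 1)).weight_mul_pow_le hε (j := 0) (by omega) (by omega)
      rw [pow_zero, mul_one] at h2
      have h3 : (1 / 4 : ℝ) ^ (k + 1) = (1 / 2) ^ (k + 1) * (1 / 2) ^ (k + 1) := by
        rw [← mul_pow]; norm_num
      have h4 : (1 / 2 : ℝ) ^ (k + 1) ≤ 1 / 2 :=
        pow_le_of_le_one (by norm_num) (by norm_num) (by omega)
      have h5 : (0 : ℝ) < (1 / 2) ^ (k + 1) := by positivity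
      nlinarith

end NodeMeasure

/-! ### Normalization and conclusion -/

section Main

open Polynomial

theorem exists_symmetric_measure {u ε : ℕ → ℝ} (hε : ∀ n, 0 < ε n) (hu : ∀ n, 0 < u n)
    (hu0 : 1 ≤ u 0) (hε0 : ε 0 = 1 / 2) (hlt : ∀ n, u n + 4 / ε (n + 1) < u (n + 1))
    (hsmall : ∀ δ > 0, ∃ n, 2 * ε n + 4 * (1 / 2 : ℝ) ^ n < δ) :
    ∃ μ : Measure ℝ, IsProbabilityMeasure μ ∧ μ.IsNegInvariant ∧ HasAllMoments μ ∧
      (∀ (n d : ℕ) (p : ℝ[X]), p.degree < (2 * (n + 1) : ℕ) →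
        ‖coeffVec d p‖ ^ 2 ≤ 2 * u n * ∫ y, p.eval y ^ 2 ∂μ) ∧
      ∀ δ > 0, ∃ (n : ℕ) (x : ℕ → ℝ), (∀ k, x k ≠ 0) ∧
        ∫ y, (nodePoly x n).eval y ^ 2 ∂μ < δ := by
  obtain ⟨x, h⟩ := exists_nodes hε hu hu0 hε0 hlt
  set μ₀ := symmetricSum (nodeWeight x ε) x
  have hmom : HasAllMoments μ₀ := hasAllMoments_symmetricSum hε h
  have := hmom.isFiniteMeasure
  obtain ⟨hM1, hM2⟩ := integral_one_nodeMeasure hε hε0 h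
  set M := ∫ _, (1 : ℝ) ∂μ₀
  have hMuniv : μ₀ Set.univ = ENNReal.ofReal M := by
    simp [M]
  have hint : ∀ f : ℝ → ℝ, ∫ y, f y ∂(ENNReal.ofReal M⁻¹ • μ₀) = M⁻¹ * ∫ y, f y ∂μ₀ := fun f => by
    rw [integral_smul_measure, ENNReal.toReal_ofReal (by positivity), smul_eq_mul]
  refine ⟨ENNReal.ofReal M⁻¹ • μ₀, ⟨?_⟩, ⟨?_⟩, fun n => (hmom n).smul_measure ENNReal.ofReal_ne_top,
    fun n d p hp => ?_, fun δ hδ => ?_⟩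
  · rw [Measure.smul_apply, hMuniv, smul_eq_mul, ← ENNReal.ofReal_mul (by positivity),
      inv_mul_cancel₀ (by positivity), ENNReal.ofReal_one]
  · rw [Measure.neg, Measure.map_smul, map_neg_symmetricSum]
  · have h1 := (h n).energy_ge p hp d
    have h2 := nodeEnergy_le_integral hε h (n + 1) p
    rw [hint]
    have h3 : 0 ≤ ∫ y, p.eval y ^ 2 ∂μ₀ := integral_nonneg fun y => sq_nonneg _
    -- Total mass at most `2` is the source of the factor `1 / 2` in the theorem.
    have h4 : (1 : ℝ) ≤ 2 * M⁻¹ := by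
      rw [← div_eq_mul_inv, le_div_iff₀ (by positivity)]; linarith
    calc _ ≤ u n * ∫ y, p.eval y ^ 2 ∂μ₀ := h1.trans (mul_le_mul_of_nonneg_left h2 (hu n).le)
      _ ≤ (2 * M⁻¹) * (u n * ∫ y, p.eval y ^ 2 ∂μ₀) :=
          le_mul_of_one_le_left (mul_nonneg (hu n).le h3) h4
      _ = _ := by ring
  · obtain ⟨n, hn⟩ := hsmall δ hδ
    refine ⟨n, x, fun k => (h k).ne_zero, ?_⟩
    rw [hint]
    refine lt_of_le_of_lt ?_ hn
    exact (mul_le_of_le_one_left (integral_nonneg fun y => sq_nonneg _)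
      (inv_le_one_of_one_le₀ hM1)).trans (integral_nodePoly_sq_le hε h n)

end Main

theorem theorem3p5 (τ : ℕ → ℝ) (hτ_anti : Antitone τ) (hτ_pos : ∀ n : ℕ, 0 < τ n)
    (hτ_lim : Tendsto τ atTop (𝓝 0)) (hτ_zero : τ 0 < 1) :
    ∃ μ : Measure ℝ, IsProbabilityMeasure μ ∧ μ.IsNegInvariant ∧ IsDeterminate μ ∧
      (∀ N : ℕ, τ N / 2 ≤ smallestHankelEigenvalue μ N) ∧
      Tendsto (fun N : ℕ => smallestHankelEigenvalue μ N) atTop (𝓝 0) := by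
  have htwo : Tendsto (fun n : ℕ => 2 * n) atTop atTop :=
    tendsto_id.const_mul_atTop' two_pos
  obtain ⟨u, hu0, humono, hut, huB⟩ := exists_strictMono_unbounded_increments
    (t := fun n => (τ (2 * n))⁻¹)
    (fun i j hij => inv_anti₀ (hτ_pos _) (hτ_anti (by omega)))
    ((tendsto_nhdsWithin_iff.2 ⟨hτ_lim, Eventually.of_forall hτ_pos⟩).inv_tendsto_nhdsGT_zero.comp
      htwo)
    ((one_lt_inv₀ (hτ_pos _)).2 hτ_zero)
  have hupos : ∀ n, 0 < u n := fun n => by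
    linarith [humono.monotone (Nat.zero_le n)]
  -- The numerator `8` makes `4 / ε (n + 1)` half the increment of `u`, leaving the strict slack
  -- needed for choosing nodes.
  set ε : ℕ → ℝ := fun n => Nat.casesOn n (1 / 2) fun n => 8 / (u (n + 1) - u n)
  have hεs : ∀ n, ε (n + 1) = 8 / (u (n + 1) - u n) := fun n => rfl
  have hinc : ∀ n, 0 < u (n + 1) - u n := fun n => sub_pos.2 (humono (Nat.lt_succ_self n))
  have hεpos : ∀ n, 0 < ε n := fun n => by
    cases n with
    | zero => exact one_half_pos
    | succ n => rw [hεs]; exact div_pos (by norm_num) (hinc n)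
  obtain ⟨μ, hprob, hsymm, hmom, hlow, hsmall⟩ := exists_symmetric_measure hεpos hupos hu0.ge rfl
    (fun n => by
      have e : 4 / ε (n + 1) = (u (n + 1) - u n) / 2 := by
        rw [hεs]; field_simp [(hinc n).ne']; ring
      rw [e]; linarith [hinc n])
    (fun δ hδ => by
      obtain ⟨n₀, hn₀⟩ := exists_pow_lt_of_lt_one (show 0 < δ / 8 by positivity)
        (show (1 / 2 : ℝ) < 1 by norm_num)
      -- The summand `64 / δ` makes `ε (n + 1)` small; the summand `u n₀` forces `n + 1 > n₀` by
      -- monotonicity, so the geometric term is small at the same index.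
      obtain ⟨n, hn⟩ := huB (u n₀ + 64 / δ)
      refine ⟨n + 1, ?_⟩
      have h1 : u n₀ < u (n + 1) := by
        have : 0 < 64 / δ := by positivity
        linarith [hupos n]
      have h2 : (1 / 2 : ℝ) ^ (n + 1) ≤ (1 / 2) ^ n₀ :=
        pow_le_pow_of_le_one (by norm_num) (by norm_num) (humono.lt_iff_lt.1 h1).le
      have h3 : ε (n + 1) ≤ δ / 8 := by
        rw [hεs, div_le_iff₀ (hinc n)]
        have : δ / 8 * (64 / δ) = 8 := by field_simp; norm_num
        have h4 : 64 / δ ≤ u (n + 1) - u n := by linarith [hupos n₀]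
        linarith [mul_le_mul_of_nonneg_left h4 (show 0 ≤ δ / 8 by positivity)]
      linarith)
  have hlower : ∀ N : ℕ, τ N / 2 ≤ smallestHankelEigenvalue μ N := fun N =>
    le_smallestHankelEigenvalue hmom fun p hp => by
      have hdeg : p.degree < (2 * (N / 2 + 1) : ℕ) :=
        p.degree_le_natDegree.trans_lt (by exact_mod_cast (by omega))
      have h1 := hlow (N / 2) (N + 1) p hdeg
      rw [norm_coeffVec_sq, Finset.sum_range] at h1
      -- Rounding down is harmless: `2 * (N / 2) ≤ N` and `τ` is antitone.
      have h2 : u (N / 2) ≤ (τ N)⁻¹ :=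
        (hut _).trans (inv_anti₀ (hτ_pos _) (hτ_anti (Nat.mul_div_le N 2)))
      have h3 : 0 ≤ ∫ y, p.eval y ^ 2 ∂μ := integral_nonneg fun y => sq_nonneg _
      have h4 := mul_le_mul_of_nonneg_right h2 h3
      have h5 : τ N * ((τ N)⁻¹ * ∫ y, p.eval y ^ 2 ∂μ) = ∫ y, p.eval y ^ 2 ∂μ :=
        mul_inv_cancel_left₀ (hτ_pos N).ne' _
      nlinarith [mul_le_mul_of_nonneg_left h1 (hτ_pos N).le,
        mul_le_mul_of_nonneg_left h4 (hτ_pos N).le]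
  refine ⟨μ, hprob, hsymm, isDeterminate_of_exists_small hmom fun δ hδ => ?_, hlower, ?_⟩
  · obtain ⟨n, x, -, hn⟩ := hsmall δ hδ
    obtain ⟨T, c, hc, hT⟩ := nodePoly_eq_C_add x n
    exact ⟨nodePoly x n, T, c, hc, hT, hn⟩
  · refine tendsto_order.2 ⟨fun a ha => Eventually.of_forall fun N =>
      ha.trans ((half_pos (hτ_pos N)).trans_le (hlower N)), fun δ hδ => ?_⟩
    obtain ⟨n, x, hx, hn⟩ := hsmall δ hδ
    filter_upwards [eventually_ge_atTop (2 * n)] with N hN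
    have hdeg : (nodePoly x n).natDegree ≤ N :=
      (Polynomial.natDegree_eq_of_degree_eq_some (degree_nodePoly fun k _ => hx k)).trans_le hN
    -- The constant coefficient is `1`, so the Rayleigh bound gives `λ_N ≤ ∫ P ^ 2`.
    have h1 : 1 ≤ ∑ i : Fin (N + 1), (nodePoly x n).coeff i ^ 2 := by
      have := Finset.single_le_sum (f := fun i : Fin (N + 1) => (nodePoly x n).coeff i ^ 2)
        (fun i _ => sq_nonneg _) (Finset.mem_univ 0)
      simpa [nodePoly_coeff_zero] using this
    have h2 : 0 ≤ smallestHankelEigenvalue μ N := (half_pos (hτ_pos N)).le.trans (hlower N)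
    exact ((le_mul_of_one_le_right h2 h1).trans (smallestHankelEigenvalue_mul_le hmom hdeg)).trans_lt
      hn
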